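/- Consider a platoon of $N\ge 2$ identical vehicles indexed $1,\dots,N$ (vehicle $1$ is the leader) with rational transfer function $R(s)=b(s)/a(s)$ and controller $C(s)=q(s)/p(s)$, both real rational functions in lowest terms, and open loop $M=RC$. The positions and external inputs satisfy $y=M(-Ly+r)$, where $L\in\mathbb R^{N\times N}$ is the path-graph Laplacian with zero first row, $i$-th row given by $L_{i,i-1}=-1$, $L_{i,i}=1+\varepsilon_i$, $L_{i,i+1}=-\varepsilon_i$ for $1<i<N$ (all other entries zero), and last row given by $L_{N,N-1}=-1$, $L_{N,N}=1$ (all other entries zero); the constants of bidirectionality satisfy $\varepsilon_i\ge 0$. Let $T_{c,o}(s)=y_o(s)/r_c(s)$ be the transfer functions of the platoon, and let $\|G\|_\infty=\sup_{\omega\ge 0}|G(\jmath\omega)|$. The platoon is called asymptotically stable if $\det\bigl(a(s)p(s)I+b(s)q(s)L'\bigr)$ has all its roots in the open left half-plane, where $L'$ is $L$ without the row and the column of the leader. It is called bidirectionally string-stable if, for an input $r_c$ at any vehicle $c$, $\|y_o/y_{o-1}\|_\infty=\|T_{c,o}/T_{c,o-1}\|_\infty\le 1$ for all $o>c$ and $\|y_{o-1}/y_o\|_\infty=\|T_{c,o-1}/T_{c,o}\|_\infty\le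 1$ for all $2\le o<c$ (with $0/0=0$ when vehicle $c$ has no influence ahead). **Lemma (design of a predecessor following controller).** Suppose that $M=RC$ has at least one integrator (a pole at $s=0$) and that, for some $N\ge2$ and some $\varepsilon_i\ge0$, the platoon with vehicle $R$ and controller $C$ is asymptotically stable and bidirectionally string-stable. Then for the same vehicle $R$ there is a predecessor following controller, that is, a controller $\tilde C$ such that the platoons with $\varepsilon_i=0$ for all $i$ are asymptotically stable for every number of vehicles and the closed loop $T=R\tilde C/(1+R\tilde C)$ satisfies $\|T\|_\infty=1$. In fact the nonzero (real) eigenvalues of $L$ have a positive lower bound, and for every such lower bound $\lambda_{\min}>0$ the scaled controller $\tilde C=\lambda_{\min}C$ has these properties. -/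

import Mathlib

open scoped ENNReal Polynomial

noncomputable section

/-- The norm `sup_{ω ≥ 0} |G(jω)|` of a real rational transfer function, with values in `[0, ∞]`.
At a pole on the imaginary axis `RatFunc.eval` returns `0`, which does not matter:
`|G|` is unbounded near such a pole, so the supremum is `∞`. -/
def hinfNorm (G : RatFunc ℝ) : ℝ≥0∞ :=
  ⨆ (ω : ℝ) (_ : 0 ≤ ω), ‖G.eval (algebraMap ℝ ℂ) ((ω : ℂ) * Complex.I)‖ₑ

/-- The number of integrators of `G`: the order of the pole of `G` at `s = 0`, that is, the least
`η` for which `s ^ η * G(s)` is finite at `0`. (`G.denom` is the denominator in lowest terms.) -/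
def numIntegrators (G : RatFunc ℝ) : ℕ :=
  G.denom.rootMultiplicity 0

/-- The standard closed loop `G / (1 + G)` of an open loop `G`. -/
def closedLoop (G : RatFunc ℝ) : RatFunc ℝ :=
  G / (1 + G)

/-- The Laplacian of a platoon of `n + 1` vehicles: index `0` is the leader, indices `1, …, n`
are the followers, `Fin.last n` is the trailing vehicle, and `ε i` is the constant of
bidirectionality of vehicle `i` (not used for the leader and for the trailing vehicle). -/
def platoonLaplacian (n : ℕ) (ε : Fin (n + 1) → ℝ) : Matrix (Fin (n + 1)) (Fin (n + 1)) ℝ :=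
  Matrix.of fun i j =>
    if i = 0 then 0
    else if (j : ℕ) + 1 = i then -1
    else if j = i then (if i = Fin.last n then 1 else 1 + ε i)
    else if (j : ℕ) = i + 1 then -ε i
    else 0

/-- The Laplacian with the row and the column of the leader deleted. -/
def reducedLaplacian (n : ℕ) (ε : Fin (n + 1) → ℝ) : Matrix (Fin n) (Fin n) ℝ :=
  (platoonLaplacian n ε).submatrix Fin.succ Fin.succ

/-- The transfer matrix `T(s)` of the platoon with vehicle `R` and controller `K`: the control law
is `e = -L y + r` and the vehicles obey `y = R K e`, hence `(I + R K L) y = R K r`.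
The entry `(o, c)` is the transfer function from the input `r_c` to the output `y_o`. -/
def transferMatrix (R K : RatFunc ℝ) (n : ℕ) (ε : Fin (n + 1) → ℝ) :
    Matrix (Fin (n + 1)) (Fin (n + 1)) (RatFunc ℝ) :=
  (R * K) • (1 + (R * K) • (platoonLaplacian n ε).map (algebraMap ℝ (RatFunc ℝ)))⁻¹

/-- The characteristic polynomial `det (a p I + b q L')` of the followers of the platoon, where
`R = b / a` and `K = q / p` in lowest terms and `L'` is the reduced Laplacian.
Factors that cancel between the vehicle and the controller are kept. -/
def platoonCharpoly (R K : RatFunc ℝ) (n : ℕ) (ε : Fin (n + 1) → ℝ) : ℝ[X] :=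
  ((R.denom * K.denom) • (1 : Matrix (Fin n) (Fin n) ℝ[X]) +
    (R.num * K.num) • (reducedLaplacian n ε).map (Polynomial.C : ℝ → ℝ[X])).det

/-- Asymptotic stability of the platoon (the leader, which drives independently, is excluded):
all roots of the characteristic polynomial lie in the open left half-plane. -/
def PlatoonStable (R K : RatFunc ℝ) (n : ℕ) (ε : Fin (n + 1) → ℝ) : Prop :=
  ∀ z : ℂ, Polynomial.aeval z (platoonCharpoly R K n ε) = 0 → z.re < 0

/-- Bidirectional string stability, for an input at any vehicle `c`. Here the consecutive vehicles
`o - 1` and `o` are `k.castSucc` and `k.succ`: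
`‖y_o / y_{o-1}‖_∞ ≤ 1` for `o > c` and `‖y_{o-1} / y_o‖_∞ ≤ 1` for `o < c`.
(If vehicle `c` does not influence the vehicles ahead of it, the second ratio is `0 / 0 = 0`.) -/
def BidirectionallyStringStable (R K : RatFunc ℝ) (n : ℕ) (ε : Fin (n + 1) → ℝ) : Prop :=
  ∀ (c : Fin (n + 1)) (k : Fin n),
    (c < k.succ →
      hinfNorm (transferMatrix R K n ε k.succ c / transferMatrix R K n ε k.castSucc c) ≤ 1) ∧
    (k.succ < c →
      hinfNorm (transferMatrix R K n ε k.castSucc c / transferMatrix R K n ε k.succ c) ≤ 1)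

/-- `lam` is a positive lower bound of the nonzero eigenvalues of the Laplacian. -/
def IsEigenvalueLowerBound (n : ℕ) (ε : Fin (n + 1) → ℝ) (lam : ℝ) : Prop :=
  0 < lam ∧
    ∀ μ : ℝ, Module.End.HasEigenvalue (Matrix.toLin' (platoonLaplacian n ε)) μ → μ ≠ 0 → lam ≤ μ

/-- With the vehicle `R`, the controller `K` makes predecessor-following platoons (all constants
of bidirectionality zero) of every length asymptotically stable, and its closed loop
`R K / (1 + R K)` has norm exactly one. -/
def AchievesPredecessorFollowing (R K : RatFunc ℝ) : Prop :=
  (∀ m : ℕ, PlatoonStable R K m (fun _ => 0)) ∧ hinfNorm (closedLoop (R * K)) = 1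

end

/-! Write `M = B/A` with `A = ap` and `B = bq`, cancelled factors kept. The trailing vehicle sees
only its predecessor, so for an input at the leader the last ratio `y_N / y_{N-1}` is `M / (1 + M)`
whatever the `ε_i` are (`transferMatrix_ratio_last`). String stability thus gives `|B| ≤ |A + B|` on
the imaginary axis. Squared, `|tB| ≤ |A + tB|` reads `|A|² + 2t Re(A B̄) ≥ 0`, which is affine in
`t` and true at `t = 0`, so it passes from `t = 1` to all `t ∈ [0, 1]` (`norm_le_norm_add_of_le`).

The Laplacian has an eigenvalue `x ∈ (0, 1]` whose eigenvector vanishes at the leader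
(`exists_eigenvector`), so stability of the platoon makes `A + xB` Hurwitz. Hence `xB / (A + xB)` is
analytic in the right half-plane and its bound by 1 extends there from the axis
(`norm_aeval_le_of_axis_of_stable`). Applied pointwise, the affine argument now gives `|λB| ≤ |A +
λB|` there for `0 < λ ≤ x`: a zero of `A + λB` in that half-plane would be a common zero of `A` and
`B`, hence of `A + xB`. So `A + λB` is Hurwitz, and its powers are the predecessor-following
characteristic polynomials. The norm is at most 1 by the axis bound, and at least 1 because an
integrator forces `T(0) = 1`. -/

/-! ### Rows of the Laplacian. -/

theorem platoonLaplacian_zero_row (n : ℕ) (ε : Fin (n + 1) → ℝ) (j : Fin (n + 1)) :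
    platoonLaplacian n ε 0 j = 0 := by
  simp [platoonLaplacian]

theorem platoonLaplacian_sum_last {S : Type*} [CommRing S] (f : ℝ →+* S) (m : ℕ)
    (ε : Fin (m + 2) → ℝ) (v : Fin (m + 2) → S) :
    ∑ j, f (platoonLaplacian (m + 1) ε (Fin.last m).succ j) * v j =
      v (Fin.last m).succ - v (Fin.last m).castSucc := by
  have key : ∀ j, f (platoonLaplacian (m + 1) ε (Fin.last m).succ j) * v j =
      (if j = (Fin.last m).succ then v j else 0) -
        (if j = (Fin.last m).castSucc then v j else 0) := by
    intro j
    have hj := j.isLt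
    simp only [platoonLaplacian, Matrix.of_apply, Fin.ext_iff, Fin.val_succ, Fin.val_last,
      Fin.val_castSucc, Fin.val_zero]
    by_cases h1 : (j : ℕ) = m
    · simp [h1]
    · by_cases h2 : (j : ℕ) = m + 1
      · simp [h2]
      · simp [h1, h2, show (j : ℕ) ≠ m + 1 + 1 by omega]
  simp only [key, Finset.sum_sub_distrib, Finset.sum_ite_eq', Finset.mem_univ, if_true]

theorem platoonLaplacian_sum_middle {S : Type*} [CommRing S] (f : ℝ →+* S) (m : ℕ)
    (ε : Fin (m + 2) → ℝ) (v : Fin (m + 2) → S) (k : Fin m) :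
    ∑ j, f (platoonLaplacian (m + 1) ε k.castSucc.succ j) * v j =
      (1 + f (ε k.castSucc.succ)) * v k.castSucc.succ - v k.castSucc.castSucc -
        f (ε k.castSucc.succ) * v k.succ.succ := by
  have key : ∀ j, f (platoonLaplacian (m + 1) ε k.castSucc.succ j) * v j =
      (if j = k.castSucc.succ then (1 + f (ε k.castSucc.succ)) * v j else 0) -
        (if j = k.castSucc.castSucc then v j else 0) -
        (if j = k.succ.succ then f (ε k.castSucc.succ) * v j else 0) := by
    intro j
    have hk := k.isLt
    simp only [platoonLaplacian, Matrix.of_apply, Fin.ext_iff, Fin.val_succ, Fin.val_last,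
      Fin.val_castSucc, Fin.val_zero]
    by_cases h1 : (j : ℕ) = k
    · simp [h1, show (k : ℕ) ≠ k + 1 + 1 by omega]
    · by_cases h2 : (j : ℕ) = k + 1
      · simp [h2, hk.ne]
      · by_cases h3 : (j : ℕ) = k + 1 + 1
        · simp [h3, show (k : ℕ) + 1 + 1 ≠ k by omega]
        · simp [h1, h2, h3]
  simp only [key, Finset.sum_sub_distrib, Finset.sum_ite_eq', Finset.mem_univ, if_true]

/-! ### Eigenvalues of the Laplacian through a three-term recurrence. -/

/-- The displacement of the `k`-th vehicle from the rear end in an eigenvector of the platoon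
Laplacian for `x`, relative to the trailing vehicle; `e k` is the constant of bidirectionality of
vehicle `k + 1` from the rear. -/
noncomputable def trailingContinuant (e : ℕ → ℝ) (x : ℝ) : ℕ → ℝ
  | 0 => 1
  | 1 => 1 - x
  | k + 2 => (1 + e k - x) * trailingContinuant e x (k + 1) - e k * trailingContinuant e x k

theorem continuous_trailingContinuant (e : ℕ → ℝ) (k : ℕ) :
    Continuous fun x => trailingContinuant e x k := by
  induction k using Nat.twoStepInduction with
  | zero => simpa [trailingContinuant] using continuous_const
  | one => simp only [trailingContinuant]; fun_prop
  | more k h0 h1 => simp only [trailingContinuant]; fun_prop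

/-- The increments satisfy `d (k+2) - d (k+1) = e k * (d (k+1) - d k) - x * d (k+1)`, and both terms
are nonnegative for `x ≤ 0`. This excludes negative eigenvalues. -/
theorem one_le_trailingContinuant {e : ℕ → ℝ} (he : ∀ k, 0 ≤ e k) {x : ℝ} (hx : x ≤ 0) (k : ℕ) :
    1 ≤ trailingContinuant e x k ∧ trailingContinuant e x k ≤ trailingContinuant e x (k + 1) := by
  induction k with
  | zero => simp [trailingContinuant, hx]
  | succ k ih =>
    refine ⟨ih.1.trans ih.2, ?_⟩
    simp only [trailingContinuant]
    nlinarith [mul_nonneg (he k) (sub_nonneg.2 ih.2),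
      mul_nonneg (neg_nonneg.2 hx) (zero_le_one.trans (ih.1.trans ih.2))]

theorem trailingContinuant_zero (e : ℕ → ℝ) (k : ℕ) : trailingContinuant e 0 k = 1 := by
  induction k using Nat.twoStepInduction with
  | zero => rfl
  | one => simp [trailingContinuant]
  | more k h0 h1 => simp [trailingContinuant, h0, h1]

theorem exists_first_zero {f : ℝ → ℝ} (hf : Continuous f) {x : ℝ} (hx : 0 ≤ x) (h0 : 0 < f 0)
    (hfx : f x ≤ 0) : ∃ z, 0 < z ∧ z ≤ x ∧ f z = 0 ∧ ∀ y, 0 ≤ y → y ≤ z → 0 ≤ f y := by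
  have hne : (Set.Icc 0 x ∩ f ⁻¹' {0}).Nonempty := by
    obtain ⟨z, hz, hz'⟩ := intermediate_value_Icc' hx hf.continuousOn ⟨hfx, h0.le⟩
    exact ⟨z, hz, hz'⟩
  obtain ⟨z, ⟨⟨hz0, hzx⟩, hz⟩, hmin⟩ :=
    (isCompact_Icc.inter_right (isClosed_singleton.preimage hf)).exists_isLeast hne
  have hz : f z = 0 := hz
  refine ⟨z, lt_of_le_of_ne hz0 ?_, hzx, hz, fun y hy hyz => ?_⟩
  · rintro rfl
    exact h0.ne' hz
  · by_contra! hneg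
    obtain ⟨w, hw, hw'⟩ := intermediate_value_Icc' hy hf.continuousOn ⟨hneg.le, h0.le⟩
    have hzw : z ≤ w := hmin ⟨⟨hw.1, hw.2.trans (hyz.trans hzx)⟩, hw'⟩
    have : y = z := le_antisymm hyz (hzw.trans hw.2)
    rw [this, hz] at hneg
    exact hneg.false

/-- First positive zeros move left as `k` grows: at the zero of `d (k+1)` the recurrence leaves `d
(k+2) = -e k * d k ≤ 0`, while every `d k` equals 1 at the origin. They start at 1, the zero of `1 -
x`. -/
theorem exists_root_trailingContinuant {e : ℕ → ℝ} (he : ∀ k, 0 ≤ e k) (k : ℕ) :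
    ∃ x, 0 < x ∧ x ≤ 1 ∧ trailingContinuant e x (k + 1) = 0 ∧ ∀ y, 0 ≤ y → y ≤ x →
      0 ≤ trailingContinuant e y k ∧ 0 ≤ trailingContinuant e y (k + 1) := by
  induction k with
  | zero =>
    refine ⟨1, one_pos, le_rfl, by simp [trailingContinuant], fun y _ hy => ?_⟩
    simpa [trailingContinuant] using hy
  | succ k ih =>
    obtain ⟨x, hx0, hx1, hx, hpos⟩ := ih
    have hle : trailingContinuant e x (k + 2) ≤ 0 := by
      simp only [trailingContinuant, hx, mul_zero, zero_sub, neg_nonpos]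
      exact mul_nonneg (he k) (hpos x hx0.le le_rfl).1
    obtain ⟨z, hz0, hzx, hz, hz'⟩ := exists_first_zero
      (continuous_trailingContinuant e (k + 2)) hx0.le (by simp [trailingContinuant_zero]) hle
    exact ⟨z, hz0, hzx.trans hx1, hz, fun y hy hyz => ⟨(hpos y hy (hyz.trans hzx)).2, hz' y hy hyz⟩⟩

/-- The constants of bidirectionality, counted from the rear. -/
def reversedConstants (m : ℕ) (ε : Fin (m + 2) → ℝ) (k : ℕ) : ℝ :=
  ε (Fin.ofNat (m + 2) (m - k))

theorem trailingContinuant_step (m : ℕ) (ε : Fin (m + 2) → ℝ) (x : ℝ) (k : Fin m) :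
    trailingContinuant (reversedConstants m ε) x (m + 1 - k) =
      (1 + ε k.castSucc.succ - x) * trailingContinuant (reversedConstants m ε) x (m - k) -
      ε k.castSucc.succ * trailingContinuant (reversedConstants m ε) x (m - (k + 1)) := by
  obtain ⟨t, ht⟩ : ∃ t, m = k + 1 + t := ⟨m - (k + 1), by omega⟩
  have h1 : m + 1 - (k : ℕ) = t + 2 := by omega
  have h2 : m - (k : ℕ) = t + 1 := by omega
  have h3 : m - ((k : ℕ) + 1) = t := by omega
  have h4 : reversedConstants m ε t = ε k.castSucc.succ := by
    unfold reversedConstants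
    congr 1
    ext
    rw [Fin.val_ofNat, Nat.mod_eq_of_lt (by omega)]
    simp only [Fin.val_succ, Fin.val_castSucc]
    omega
  rw [h1, h2, h3, trailingContinuant, h4]

/-- The recurrence encodes the follower rows; the zero row of the leader requires the leader's entry
to vanish, which is the root condition on `x`. -/
theorem exists_eigenvector (m : ℕ) (ε : Fin (m + 2) → ℝ) (hε : ∀ i, 0 ≤ ε i) :
    ∃ x : ℝ, 0 < x ∧ x ≤ 1 ∧ ∃ v : Fin (m + 2) → ℝ, v ≠ 0 ∧ v 0 = 0 ∧
      (platoonLaplacian (m + 1) ε).mulVec v = x • v := by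
  obtain ⟨x, hx0, hx1, hx, -⟩ :=
    exists_root_trailingContinuant (e := reversedConstants m ε) (fun k => hε _) m
  refine ⟨x, hx0, hx1, fun i => trailingContinuant (reversedConstants m ε) x (m + 1 - i), ?_,
    by simpa using hx, ?_⟩
  · intro h
    simpa [trailingContinuant] using congrFun h (Fin.last (m + 1))
  · ext i
    simp only [Matrix.mulVec, dotProduct, Pi.smul_apply, smul_eq_mul]
    induction i using Fin.cases with
    | zero => simp [platoonLaplacian_zero_row, hx]
    | succ i =>
      induction i using Fin.lastCases with
      | last =>
        have := platoonLaplacian_sum_last (RingHom.id ℝ) m ε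
          (fun i => trailingContinuant (reversedConstants m ε) x (m + 1 - i))
        simp only [RingHom.id_apply] at this
        rw [this]
        simp [trailingContinuant]
      | cast k =>
        have := platoonLaplacian_sum_middle (RingHom.id ℝ) m ε
          (fun i => trailingContinuant (reversedConstants m ε) x (m + 1 - i)) k
        simp only [RingHom.id_apply, Fin.val_succ, Fin.val_castSucc, Nat.add_sub_add_right] at this
        simp only [Fin.val_succ, Fin.val_castSucc, Nat.add_sub_add_right]
        rw [this, trailingContinuant_step]
        ring

/-- Each row has coefficient `-1` at the predecessor, so zeros propagate from the rear to the
leader. This is what keeps the denominator `y_{N-1}` nonzero. -/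
theorem eq_zero_of_trailing {S : Type*} [Field S] (m : ℕ) (c : S) (hc : c ≠ 0)
    (f : ℝ →+* S) (ε : Fin (m + 2) → ℝ) (y : Fin (m + 2) → S)
    (h : ∀ i : Fin (m + 1), y i.succ +
      c * ∑ j, f (platoonLaplacian (m + 1) ε i.succ j) * y j = 0)
    (h0 : y (Fin.last m).castSucc = 0) (h1 : y (Fin.last m).succ = 0) : y 0 = 0 := by
  have key : ∀ k : Fin (m + 1), y k.castSucc = 0 ∧ y k.succ = 0 := by
    intro k
    induction k using Fin.reverseInduction with
    | last => exact ⟨h0, h1⟩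
    | cast k ih =>
      obtain ⟨ha, hb⟩ := ih
      have ha' : y k.castSucc.succ = 0 := by rwa [Fin.succ_castSucc]
      have := h k.castSucc
      rw [platoonLaplacian_sum_middle, ha', hb] at this
      simp [hc] at this
      exact ⟨this, ha'⟩
  simpa using (key 0).1

/-- An eigenvector is its last entry times the recurrence values. For `x < 0` these are at least 1,
so the vanishing entry of the leader kills the whole vector. -/
theorem eigenvalue_pos (m : ℕ) (ε : Fin (m + 2) → ℝ) (hε : ∀ i, 0 ≤ ε i) (x : ℝ) (hx : x ≠ 0)
    (h : Module.End.HasEigenvalue (Matrix.toLin' (platoonLaplacian (m + 1) ε)) x) : 0 < x := by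
  obtain ⟨v, hv, hv0⟩ := h.exists_hasEigenvector
  rw [Module.End.mem_eigenspace_iff, Matrix.toLin'_apply] at hv
  have hrow : ∀ i, ∑ j, platoonLaplacian (m + 1) ε i j * v j = x * v i := fun i => congrFun hv i
  have hv00 : v 0 = 0 := by simpa [platoonLaplacian_zero_row, hx] using (hrow 0).symm
  set d := trailingContinuant (reversedConstants m ε) x with hd
  have key : ∀ k : Fin (m + 1), v k.castSucc = d (m + 1 - k) * v (Fin.last m).succ ∧
      v k.succ = d (m - k) * v (Fin.last m).succ := by
    intro k
    induction k using Fin.reverseInduction with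
    | last =>
      have := platoonLaplacian_sum_last (RingHom.id ℝ) m ε v
      simp only [RingHom.id_apply, hrow] at this
      simp only [Fin.val_last, Nat.add_sub_cancel_left, Nat.sub_self, hd, trailingContinuant]
      constructor <;> linarith
    | cast k ih =>
      obtain ⟨ha, hb⟩ := ih
      rw [← Fin.succ_castSucc] at ha
      simp only [Fin.val_succ, Nat.add_sub_add_right] at ha hb
      have := platoonLaplacian_sum_middle (RingHom.id ℝ) m ε v k
      simp only [RingHom.id_apply, hrow] at this
      refine ⟨?_, by simpa using ha⟩
      rw [Fin.val_castSucc, hd, trailingContinuant_step, ← hd]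
      rw [ha, hb] at this
      linear_combination this
  by_contra! hneg
  have hd1 : ∀ k, d k ≠ 0 := fun k =>
    (one_pos.trans_le (one_le_trailingContinuant (fun k => hε _) hneg k).1).ne'
  have hlast : v (Fin.last m).succ = 0 := by
    have := (key 0).1
    simpa [hv00, hd1] using this
  apply hv0
  ext i
  induction i using Fin.cases with
  | zero => simpa using hv00
  | succ i => rw [(key i).2, hlast, mul_zero, Pi.zero_apply]

theorem exists_isEigenvalueLowerBound (m : ℕ) (ε : Fin (m + 2) → ℝ) (hε : ∀ i, 0 ≤ ε i) :
    ∃ lam : ℝ, IsEigenvalueLowerBound (m + 1) ε lam := by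
  set s := (Module.End.finite_hasEigenvalue
    (Matrix.toLin' (platoonLaplacian (m + 1) ε))).toFinset.filter (· ≠ 0)
  obtain hs | hs := s.eq_empty_or_nonempty
  · refine ⟨1, one_pos, fun μ hμ h0 => ?_⟩
    have : μ ∈ s := by simp [s, hμ, h0]
    simp [hs] at this
  · refine ⟨s.min' hs, ?_, fun μ hμ h0 => s.min'_le μ (by simp [s, hμ, h0])⟩
    have := s.min'_mem hs
    simp only [s, Finset.mem_filter, Set.Finite.mem_toFinset, Set.mem_ofPred_eq] at this
    exact eigenvalue_pos m ε hε _ this.2 this.1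

/-! ### From the norm to polynomial inequalities on the imaginary axis. -/

theorem norm_le_norm_add_of_le (a b : ℂ) (s t : ℝ) (ht : 0 ≤ t) (hs : 0 < s) (hts : t ≤ s)
    (h : ‖s * b‖ ≤ ‖a + s * b‖) : ‖t * b‖ ≤ ‖a + t * b‖ := by
  rw [← sq_le_sq₀ (norm_nonneg _) (norm_nonneg _), ← Complex.normSq_eq_norm_sq,
    ← Complex.normSq_eq_norm_sq] at h ⊢
  simp only [Complex.normSq_apply, Complex.add_re, Complex.add_im, Complex.mul_re, Complex.mul_im,
    Complex.ofReal_re, Complex.ofReal_im, zero_mul, sub_zero, add_zero] at h ⊢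
  have h1 : 0 ≤ s * (a.re ^ 2 + a.im ^ 2 + 2 * t * (a.re * b.re + a.im * b.im)) := by
    nlinarith [mul_nonneg ht (sub_nonneg.2 h),
      mul_nonneg (sub_nonneg.2 hts) (add_nonneg (sq_nonneg a.re) (sq_nonneg a.im))]
  nlinarith [nonneg_of_mul_nonneg_right h1 hs]

theorem aeval_conj (p : ℝ[X]) (z : ℂ) :
    Polynomial.aeval ((starRingEnd ℂ) z) p = (starRingEnd ℂ) (Polynomial.aeval z p) := by
  exact Polynomial.aeval_algHom_apply Complex.conjAe.toAlgHom z p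

/-- The set of points of the imaginary axis where a nonzero polynomial does not vanish is dense. -/
theorem dense_axis_ne_zero (q : ℝ[X]) (hq : q ≠ 0) :
    Dense {ω : ℝ | Polynomial.aeval ((ω : ℂ) * Complex.I) q ≠ 0} := by
  have hfin : {ω : ℝ | Polynomial.aeval ((ω : ℂ) * Complex.I) q = 0}.Finite := by
    refine Set.Finite.preimage (f := fun ω : ℝ => (ω : ℂ) * Complex.I) ?_ (q.rootSet_finite ℂ)
      |>.subset ?_
    · intro x _ y _ h
      simpa using h
    · intro ω hω
      exact (Polynomial.mem_rootSet).2 ⟨hq, hω⟩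
  have := hfin.countable.dense_compl ℝ
  exact this

theorem ratFunc_eval_div (p q : ℝ[X]) (z : ℂ) (hq : Polynomial.aeval z q ≠ 0) :
    (algebraMap ℝ[X] (RatFunc ℝ) p / algebraMap ℝ[X] (RatFunc ℝ) q).eval (algebraMap ℝ ℂ) z =
      Polynomial.aeval z p / Polynomial.aeval z q := by
  have hq0 : q ≠ 0 := by rintro rfl; simp at hq
  set G := algebraMap ℝ[X] (RatFunc ℝ) p / algebraMap ℝ[X] (RatFunc ℝ) q with hG
  have hd : Polynomial.aeval z G.denom ≠ 0 := by
    intro h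
    obtain ⟨c, hc⟩ := RatFunc.denom_div_dvd p q
    apply hq
    rw [hc, map_mul, ← hG, h, zero_mul]
  have h : G.num * q = p * G.denom := (RatFunc.num_mul_eq_mul_denom_iff hq0).2 hG
  have h' := congrArg (Polynomial.aeval z) h
  simp only [map_mul] at h'
  rw [RatFunc.eval, ← Polynomial.aeval_def, ← Polynomial.aeval_def, div_eq_div_iff hd hq]
  exact h'

/-- The norm controls only `ω ≥ 0` with `q ≠ 0` there. Conjugation supplies negative frequencies;
density and continuity supply the zeros of `q`. -/
theorem norm_aeval_le_of_hinfNorm_le_one (p q : ℝ[X]) (hq : q ≠ 0)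
    (h : hinfNorm (algebraMap ℝ[X] (RatFunc ℝ) p / algebraMap ℝ[X] (RatFunc ℝ) q) ≤ 1) (ω : ℝ) :
    ‖Polynomial.aeval ((ω : ℂ) * Complex.I) p‖ ≤ ‖Polynomial.aeval ((ω : ℂ) * Complex.I) q‖ := by
  have hpos : ∀ ω : ℝ, 0 ≤ ω → Polynomial.aeval ((ω : ℂ) * Complex.I) q ≠ 0 →
      ‖Polynomial.aeval ((ω : ℂ) * Complex.I) p‖ ≤
        ‖Polynomial.aeval ((ω : ℂ) * Complex.I) q‖ := by
    intro ω hω hne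
    have h1 := (le_iSup₂ (f := fun (ω : ℝ) (_ : 0 ≤ ω) =>
      ‖(algebraMap ℝ[X] (RatFunc ℝ) p / algebraMap ℝ[X] (RatFunc ℝ) q).eval (algebraMap ℝ ℂ)
        ((ω : ℂ) * Complex.I)‖ₑ) ω hω).trans h
    simp only [ratFunc_eval_div p q _ hne] at h1
    have h2 := ENNReal.toReal_mono ENNReal.one_ne_top h1
    rw [toReal_enorm, norm_div, ENNReal.toReal_one, div_le_one (norm_pos_iff.2 hne)] at h2
    exact h2
  have hall : ∀ ω : ℝ, Polynomial.aeval ((ω : ℂ) * Complex.I) q ≠ 0 →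
      ‖Polynomial.aeval ((ω : ℂ) * Complex.I) p‖ ≤
        ‖Polynomial.aeval ((ω : ℂ) * Complex.I) q‖ := by
    intro ω hne
    obtain hω | hω := le_total 0 ω
    · exact hpos ω hω hne
    · have hc : ((-ω : ℝ) : ℂ) * Complex.I = (starRingEnd ℂ) ((ω : ℂ) * Complex.I) := by simp
      have h1 := hpos (-ω) (neg_nonneg.2 hω)
      rw [hc, aeval_conj, aeval_conj, RCLike.norm_conj, RCLike.norm_conj] at h1
      exact h1 (by simpa using hne)
  have hclosed : IsClosed {ω : ℝ | ‖Polynomial.aeval ((ω : ℂ) * Complex.I) p‖ ≤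
        ‖Polynomial.aeval ((ω : ℂ) * Complex.I) q‖} :=
    isClosed_le (by fun_prop) (by fun_prop)
  have := (dense_axis_ne_zero q hq).closure_eq ▸ hclosed.closure_subset_iff.2 hall
  exact this (Set.mem_univ ω)

/-! ### A maximum principle in the right half-plane. -/

theorem norm_aeval_le_exp (p : ℝ[X]) : ∃ C : ℝ, ∀ z : ℂ,
    ‖Polynomial.aeval z p‖ ≤ C * Real.exp ‖z‖ := by
  refine ⟨∑ i ∈ Finset.range (p.natDegree + 1), ‖p.coeff i‖ * i.factorial, fun z => ?_⟩
  rw [Polynomial.aeval_eq_sum_range, Finset.sum_mul]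
  refine (norm_sum_le _ _).trans (Finset.sum_le_sum fun i _ => ?_)
  rw [norm_smul, norm_pow, mul_assoc]
  gcongr
  have := Real.pow_div_factorial_le_exp ‖z‖ (norm_nonneg z) i
  rwa [div_le_iff₀ (by positivity), mul_comm] at this

/-- A polynomial with all roots in the open left half-plane is bounded away from zero on the
closed right half-plane. -/
theorem exists_norm_aeval_ge (q : ℝ[X])
    (h : ∀ z : ℂ, Polynomial.aeval z q = 0 → z.re < 0) :
    ∃ δ : ℝ, 0 < δ ∧ ∀ z : ℂ, 0 ≤ z.re → δ ≤ ‖Polynomial.aeval z q‖ := by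
  have hq : q ≠ 0 := by
    rintro rfl
    simpa using h 0
  set Q := q.map (algebraMap ℝ ℂ) with hQ
  have hQ0 : Q ≠ 0 := (Polynomial.map_ne_zero_iff (algebraMap ℝ ℂ).injective).2 hq
  have heval : ∀ z : ℂ, Polynomial.aeval z q = Q.eval z := fun z => by
    rw [hQ, Polynomial.eval_map, Polynomial.aeval_def]
  have hroot : ∀ w ∈ Q.roots, w.re < 0 := by
    intro w hw
    apply h
    rw [heval]
    exact (Polynomial.mem_roots hQ0).1 hw
  have key : ∀ s : Multiset ℂ, (∀ w ∈ s, w.re < 0) → ∃ δ : ℝ, 0 < δ ∧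
      ∀ z : ℂ, 0 ≤ z.re → δ ≤ ‖(s.map fun w => z - w).prod‖ := by
    intro s
    induction s using Multiset.induction with
    | empty => exact fun _ => ⟨1, one_pos, by simp⟩
    | cons w s ih =>
      intro hs
      obtain ⟨δ, hδ, hz⟩ := ih fun w hw => hs w (Multiset.mem_cons_of_mem hw)
      have hw := hs w (Multiset.mem_cons_self w s)
      refine ⟨-w.re * δ, mul_pos (neg_pos.2 hw) hδ, fun z h0 => ?_⟩
      rw [Multiset.map_cons, Multiset.prod_cons, norm_mul]
      have h1 := (le_abs_self _).trans (Complex.abs_re_le_norm (z - w))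
      rw [Complex.sub_re] at h1
      exact mul_le_mul (by linarith) (hz z h0) hδ.le (norm_nonneg _)
  obtain ⟨δ, hδ, hz⟩ := key Q.roots hroot
  refine ⟨‖Q.leadingCoeff‖ * δ, mul_pos (norm_pos_iff.2 (by simpa using hQ0)) hδ, fun z h0 => ?_⟩
  rw [heval, (IsAlgClosed.splits Q).eval_eq_prod_roots, norm_mul]
  gcongr
  exact hz z h0

-- Since `p / q` is not assumed proper, it is damped by `exp (-τ z)`, which has modulus 1 on the
-- axis and forces decay along the positive reals. Phragmén–Lindelöf applies for each `τ > 0`; then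
-- `τ → 0`.
open Filter Asymptotics Bornology in
theorem norm_aeval_le_of_axis_of_stable (p q : ℝ[X])
    (hst : ∀ z : ℂ, Polynomial.aeval z q = 0 → z.re < 0)
    (haxis : ∀ ω : ℝ, ‖Polynomial.aeval ((ω : ℂ) * Complex.I) p‖ ≤
      ‖Polynomial.aeval ((ω : ℂ) * Complex.I) q‖) (z : ℂ) (hz : 0 ≤ z.re) :
    ‖Polynomial.aeval z p‖ ≤ ‖Polynomial.aeval z q‖ := by
  obtain ⟨δ, hδ, hq⟩ := exists_norm_aeval_ge q hst
  obtain ⟨C, hC⟩ := norm_aeval_le_exp p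
  have hqne : ∀ z : ℂ, 0 ≤ z.re → Polynomial.aeval z q ≠ 0 := fun z hz h0 =>
    (hst z h0).not_ge hz
  have hclos : closure {z : ℂ | 0 < z.re} = {z : ℂ | 0 ≤ z.re} := Complex.closure_setOfPred_lt_re 0
  have hbound : ∀ τ : ℝ, 0 < τ → ∀ z : ℂ, 0 ≤ z.re →
      ‖Polynomial.aeval z p / Polynomial.aeval z q * Complex.exp (-τ * z)‖ ≤ 1 := by
    intro τ hτ z hz
    refine PhragmenLindelof.right_half_plane_of_tendsto_zero_on_real
      (f := fun z => Polynomial.aeval z p / Polynomial.aeval z q * Complex.exp (-τ * z))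
      ?_ ?_ ?_ ?_ hz
    · apply DifferentiableOn.diffContOnCl
      rw [hclos]
      refine DifferentiableOn.mul (DifferentiableOn.div ?_ ?_ fun z hz => hqne z hz) ?_
      · exact (Polynomial.differentiable_aeval p).differentiableOn
      · exact (Polynomial.differentiable_aeval q).differentiableOn
      · fun_prop
    · refine ⟨1, by norm_num, 1, IsBigO.of_bound (C / δ) ?_⟩
      refine Filter.Eventually.filter_mono inf_le_right ?_
      refine Filter.eventually_principal.2 fun z hz => ?_
      have hz : 0 < z.re := hz
      have he : ‖Complex.exp (-τ * z)‖ ≤ 1 := by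
        rw [Complex.norm_exp, Real.exp_le_one_iff]
        simp only [neg_mul, Complex.neg_re, Complex.re_ofReal_mul]
        nlinarith
      rw [Real.norm_eq_abs, abs_of_pos (Real.exp_pos _), one_mul, Real.rpow_one, norm_mul, norm_div]
      calc _ ≤ ‖Polynomial.aeval z p‖ / ‖Polynomial.aeval z q‖ * 1 := by gcongr
        _ ≤ C * Real.exp ‖z‖ / δ := by
          rw [mul_one]
          exact div_le_div₀ ((norm_nonneg _).trans (hC z)) (hC z) hδ (hq z hz.le)
        _ = _ := by ring
    · have h1 : Tendsto (fun x : ℝ => (Polynomial.aeval (x : ℂ) p : ℂ) * Complex.exp (-τ * x))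
          atTop (nhds 0) := by
        -- Substituting `u = τ x` reduces the limit to a polynomial in `u` over `exp u`.
        have h2 := ((p.comp (Polynomial.C τ⁻¹ * Polynomial.X)).tendsto_div_exp_atTop).comp
          (tendsto_id.const_mul_atTop hτ)
        have h3 := (Complex.continuous_ofReal.tendsto 0).comp h2
        refine (h3.congr fun x => ?_)
        simp only [Function.comp_apply, id, Polynomial.eval_comp, Polynomial.eval_mul,
          Polynomial.eval_C, Polynomial.eval_X, inv_mul_cancel_left₀ hτ.ne']
        rw [neg_mul, Complex.exp_neg, ← Complex.coe_algebraMap,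
          Polynomial.aeval_algebraMap_apply]
        simp [div_eq_mul_inv]
      refine squeeze_zero_norm' (a := fun x : ℝ =>
        ‖(Polynomial.aeval (x : ℂ) p : ℂ) * Complex.exp (-τ * x)‖ / δ) ?_
        (by simpa using h1.norm.div_const δ)
      filter_upwards [eventually_ge_atTop 0] with x hx
      rw [norm_mul, norm_mul, norm_div, div_mul_eq_mul_div]
      gcongr
      exact hq x (by simpa using hx)
    · intro x
      have he : ‖Complex.exp (-τ * (x * Complex.I))‖ = 1 := by
        rw [Complex.norm_exp]
        simp
      rw [norm_mul, he, mul_one, norm_div]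
      exact div_le_one_of_le₀ (haxis x) (norm_nonneg _)
  have hlim : Tendsto (fun τ : ℝ =>
      ‖Polynomial.aeval z p / Polynomial.aeval z q * Complex.exp (-τ * z)‖)
      (nhdsWithin 0 (Set.Ioi 0)) (nhds ‖Polynomial.aeval z p / Polynomial.aeval z q‖) := by
    have : Continuous fun τ : ℝ =>
        ‖Polynomial.aeval z p / Polynomial.aeval z q * Complex.exp (-τ * z)‖ := by fun_prop
    simpa using (this.tendsto 0).mono_left nhdsWithin_le_nhds
  have := le_of_tendsto hlim (eventually_nhdsWithin_of_forall fun τ hτ => hbound τ hτ z hz)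
  rwa [norm_div, div_le_one (norm_pos_iff.2 (hqne z hz))] at this

/-! ### Transfer functions of the platoon. -/

/-- The ring map `g` serves twice: as the embedding into rational functions, for invertibility, and
as evaluation at a complex point, for the modes. -/
theorem map_platoonCharpoly_eq_zero {S : Type*} [CommRing S] [IsDomain S] (g : ℝ[X] →+* S)
    (R K : RatFunc ℝ) (n : ℕ) (ε : Fin (n + 1) → ℝ) (w : Fin n → S) (hw : w ≠ 0)
    (h : ∀ i, g (R.denom * K.denom) * w i + g (R.num * K.num) *
      ∑ j, g (Polynomial.C (platoonLaplacian n ε i.succ j.succ)) * w j = 0) :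
    g (platoonCharpoly R K n ε) = 0 := by
  rw [platoonCharpoly, RingHom.map_det]
  refine Matrix.exists_mulVec_eq_zero_iff.1 ⟨w, hw, ?_⟩
  have hmat : g.mapMatrix ((R.denom * K.denom) • (1 : Matrix (Fin n) (Fin n) ℝ[X]) +
      (R.num * K.num) • (reducedLaplacian n ε).map (Polynomial.C : ℝ → ℝ[X])) =
      g (R.denom * K.denom) • (1 : Matrix (Fin n) (Fin n) S) + g (R.num * K.num) •
        Matrix.of fun i j => g (Polynomial.C (platoonLaplacian n ε i.succ j.succ)) := by
    ext i j
    simp [reducedLaplacian, Matrix.one_apply, apply_ite g]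
  rw [hmat, Matrix.add_mulVec, Matrix.smul_mulVec, Matrix.smul_mulVec, Matrix.one_mulVec]
  ext i
  simpa [Matrix.mulVec, dotProduct] using h i

theorem ratFunc_mul_eq_div (R K : RatFunc ℝ) : R * K =
    algebraMap ℝ[X] (RatFunc ℝ) (R.num * K.num) /
      algebraMap ℝ[X] (RatFunc ℝ) (R.denom * K.denom) := by
  conv_lhs => rw [← RatFunc.num_div_denom R, ← RatFunc.num_div_denom K]
  rw [div_mul_div_comm, map_mul, map_mul]

theorem platoon_row (R K : RatFunc ℝ) (n : ℕ) (ε : Fin (n + 1) → ℝ) (w : Fin (n + 1) → RatFunc ℝ)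
    (i : Fin (n + 1)) :
    (1 + (R * K) • (platoonLaplacian n ε).map (algebraMap ℝ (RatFunc ℝ))).mulVec w i =
      w i + R * K * ∑ j, algebraMap ℝ (RatFunc ℝ) (platoonLaplacian n ε i j) * w j := by
  rw [Matrix.add_mulVec, Matrix.smul_mulVec, Matrix.one_mulVec]
  rfl

/-- Needed because `⁻¹` of a singular matrix is 0 by convention. A kernel vector vanishes at the
leader, so it would make the characteristic polynomial zero, with every point as a root. -/
theorem PlatoonStable.isUnit_det {R K : RatFunc ℝ} {n : ℕ} {ε : Fin (n + 1) → ℝ}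
    (h : PlatoonStable R K n ε) :
    IsUnit (1 + (R * K) • (platoonLaplacian n ε).map (algebraMap ℝ (RatFunc ℝ))).det := by
  rw [isUnit_iff_ne_zero]
  intro hdet
  obtain ⟨w, hw0, hw⟩ := Matrix.exists_mulVec_eq_zero_iff.2 hdet
  have hrow := fun i => (platoon_row R K n ε w i).symm.trans (congrFun hw i)
  have h0 : w 0 = 0 := by simpa [platoonLaplacian_zero_row] using hrow 0
  have hA : algebraMap ℝ[X] (RatFunc ℝ) (R.denom * K.denom) ≠ 0 :=
    RatFunc.algebraMap_ne_zero (mul_ne_zero R.denom_ne_zero K.denom_ne_zero)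
  have hz := map_platoonCharpoly_eq_zero (algebraMap ℝ[X] (RatFunc ℝ)) R K n ε
    (fun i => w i.succ) (fun h' => hw0 ?_) fun i => ?_
  · have hc : platoonCharpoly R K n ε = 0 := RatFunc.algebraMap_injective ℝ (by simpa using hz)
    simpa using h 0 (by simp [hc])
  · ext i
    induction i using Fin.cases with
    | zero => rw [h0, Pi.zero_apply]
    | succ i => exact congrFun h' i
  · have := hrow i.succ
    rw [Fin.sum_univ_succ, h0, mul_zero, zero_add, ratFunc_mul_eq_div R K, Pi.zero_apply] at this
    have h2 : w i.succ + algebraMap ℝ[X] (RatFunc ℝ) (R.num * K.num) /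
        algebraMap ℝ[X] (RatFunc ℝ) (R.denom * K.denom) *
        ∑ j : Fin n, algebraMap ℝ[X] (RatFunc ℝ)
          (Polynomial.C (platoonLaplacian n ε i.succ j.succ)) * w j.succ = 0 := by
      simpa only [RatFunc.algebraMap_C, RatFunc.algebraMap_eq_C] using this
    field_simp at h2
    linear_combination h2

theorem transferMatrix_ratio_last {R K : RatFunc ℝ} {m : ℕ} {ε : Fin (m + 2) → ℝ}
    (h : PlatoonStable R K (m + 1) ε) (hM : R * K ≠ 0) (hM1 : 1 + R * K ≠ 0) :
    transferMatrix R K (m + 1) ε (Fin.last m).succ 0 /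
      transferMatrix R K (m + 1) ε (Fin.last m).castSucc 0 = closedLoop (R * K) := by
  set y : Fin (m + 2) → RatFunc ℝ := fun i => transferMatrix R K (m + 1) ε i 0 with hy
  have hmul : (1 + (R * K) • (platoonLaplacian (m + 1) ε).map (algebraMap ℝ (RatFunc ℝ))) *
      transferMatrix R K (m + 1) ε = (R * K) • 1 := by
    rw [transferMatrix, Matrix.mul_smul, Matrix.mul_nonsing_inv _ h.isUnit_det]
  have hrow : ∀ i, y i + R * K * ∑ j, algebraMap ℝ (RatFunc ℝ)
      (platoonLaplacian (m + 1) ε i j) * y j = if i = 0 then R * K else 0 := by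
    intro i
    rw [← platoon_row]
    have := congrFun (congrFun hmul i) 0
    rw [Matrix.smul_apply, Matrix.one_apply, smul_eq_mul, mul_ite, mul_one, mul_zero] at this
    exact this
  have hlast := hrow (Fin.last m).succ
  rw [platoonLaplacian_sum_last, if_neg (Fin.succ_ne_zero _)] at hlast
  have hne : y (Fin.last m).castSucc ≠ 0 := by
    intro h0
    have h1 : y (Fin.last m).succ = 0 := by
      rw [h0, sub_zero] at hlast
      exact (mul_eq_zero.1 (show (1 + R * K) * y (Fin.last m).succ = 0 by
        linear_combination hlast)).resolve_left hM1
    have h2 := eq_zero_of_trailing m (R * K) hM (algebraMap ℝ (RatFunc ℝ)) ε y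
      (fun i => by rw [hrow, if_neg (Fin.succ_ne_zero _)]) h0 h1
    have h3 := hrow 0
    simp only [platoonLaplacian_zero_row, map_zero, zero_mul, Finset.sum_const_zero, mul_zero,
      h2, if_true, add_zero] at h3
    exact hM h3.symm
  rw [closedLoop]
  change y (Fin.last m).succ / y (Fin.last m).castSucc = _
  rw [div_eq_div_iff hne hM1]
  linear_combination hlast

/-! ### The scaled controller. -/

theorem closedLoop_C_mul (R K : RatFunc ℝ) (t : ℝ) :
    closedLoop (R * (RatFunc.C t * K)) =
      algebraMap ℝ[X] (RatFunc ℝ) (Polynomial.C t * (R.num * K.num)) /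
        algebraMap ℝ[X] (RatFunc ℝ)
          (R.denom * K.denom + Polynomial.C t * (R.num * K.num)) := by
  have hA : algebraMap ℝ[X] (RatFunc ℝ) (R.denom * K.denom) ≠ 0 :=
    RatFunc.algebraMap_ne_zero (mul_ne_zero R.denom_ne_zero K.denom_ne_zero)
  rw [mul_left_comm, closedLoop, ratFunc_mul_eq_div R K, map_add, map_mul _ (Polynomial.C t),
    RatFunc.algebraMap_C, ← mul_div_assoc, one_add_div hA, div_div_div_cancel_right₀ hA]

/-- Scaling by `t` and by `t⁻¹` gives divisibility both ways between monic polynomials. -/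
theorem denom_C_mul (K : RatFunc ℝ) {t : ℝ} (ht : t ≠ 0) : (RatFunc.C t * K).denom = K.denom := by
  have key : ∀ (K : RatFunc ℝ) (t : ℝ), (RatFunc.C t * K).denom ∣ K.denom := fun K t => by
    simpa using RatFunc.denom_mul_dvd (RatFunc.C t) K
  refine Polynomial.eq_of_monic_of_associated (RatFunc.monic_denom _) (RatFunc.monic_denom _)
    (associated_of_dvd_dvd (key K t) ?_)
  have := key (RatFunc.C t * K) t⁻¹
  rwa [← mul_assoc, ← map_mul, inv_mul_cancel₀ ht, map_one, one_mul] at this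

theorem num_C_mul (K : RatFunc ℝ) {t : ℝ} (ht : t ≠ 0) :
    (RatFunc.C t * K).num = Polynomial.C t * K.num := by
  have h := RatFunc.num_denom_mul (RatFunc.C t) K
  rw [denom_C_mul K ht, RatFunc.num_C, RatFunc.denom_C, one_mul] at h
  exact mul_right_cancel₀ K.denom_ne_zero h

theorem platoonCharpoly_predecessor (R K : RatFunc ℝ) (m : ℕ) :
    platoonCharpoly R K m (fun _ => 0) = (R.denom * K.denom + R.num * K.num) ^ m := by
  rw [platoonCharpoly, Matrix.det_of_isLowerTriangular]
  · simp [reducedLaplacian, platoonLaplacian]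
  · intro i j hij
    have hij : (i : ℕ) < j := hij
    have h1 : i ≠ j := fun h => by simp [h] at hij
    simp [reducedLaplacian, platoonLaplacian, h1, h1.symm,
      show (j : ℕ) + 1 ≠ i by omega]

theorem isRoot_denom_of_integrator {M : RatFunc ℝ} (h : 1 ≤ numIntegrators M) :
    M.denom.eval 0 = 0 :=
  (Polynomial.rootMultiplicity_pos M.denom_ne_zero).1 h

theorem ne_zero_of_integrator {M : RatFunc ℝ} (h : 1 ≤ numIntegrators M) :
    M ≠ 0 ∧ 1 + M ≠ 0 := by
  have h0 := isRoot_denom_of_integrator h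
  constructor
  · rintro rfl
    simp at h0
  · intro h1
    have h2 : M = RatFunc.C (-1) := by
      rw [map_neg, map_one]
      linear_combination h1
    rw [h2, RatFunc.denom_C] at h0
    simp at h0

theorem one_le_hinfNorm_closedLoop {M : RatFunc ℝ} (h : 1 ≤ numIntegrators M) {t : ℝ}
    (ht : t ≠ 0) : 1 ≤ hinfNorm (closedLoop (RatFunc.C t * M)) := by
  have hd : Polynomial.aeval (0 : ℂ) M.denom = 0 := by
    have := Polynomial.aeval_algebraMap_apply ℂ (0 : ℝ) M.denom
    rwa [map_zero, Polynomial.coe_aeval_eq_eval, isRoot_denom_of_integrator h, map_zero] at this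
  have hn : Polynomial.aeval (0 : ℂ) M.num ≠ 0 := by
    intro hn
    obtain ⟨u, v, huv⟩ := RatFunc.isCoprime_num_denom M
    have := congrArg (Polynomial.aeval (0 : ℂ)) huv
    simp only [map_add, map_mul, hd, hn, mul_zero, add_zero, map_one] at this
    exact zero_ne_one this
  have hcl := closedLoop_C_mul 1 M t
  rw [one_mul, RatFunc.num_one, RatFunc.denom_one, one_mul, one_mul] at hcl
  have hq : Polynomial.aeval (0 : ℂ) (M.denom + Polynomial.C t * M.num) ≠ 0 := by
    simp [hd, hn, ht]
  have hval := ratFunc_eval_div (Polynomial.C t * M.num) _ 0 hq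
  rw [← hcl, map_add, hd, zero_add, div_self (by simp [hn, ht])] at hval
  refine le_trans ?_ (le_iSup₂ (f := fun (ω : ℝ) (_ : 0 ≤ ω) =>
    ‖(closedLoop (RatFunc.C t * M)).eval (algebraMap ℝ ℂ) ((ω : ℂ) * Complex.I)‖ₑ) 0 le_rfl)
  simp [hval]

theorem hinfNorm_div_le_one (p q : ℝ[X])
    (hq : ∀ ω : ℝ, Polynomial.aeval ((ω : ℂ) * Complex.I) q ≠ 0)
    (h : ∀ ω : ℝ, ‖Polynomial.aeval ((ω : ℂ) * Complex.I) p‖ ≤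
      ‖Polynomial.aeval ((ω : ℂ) * Complex.I) q‖) :
    hinfNorm (algebraMap ℝ[X] (RatFunc ℝ) p / algebraMap ℝ[X] (RatFunc ℝ) q) ≤ 1 := by
  refine iSup₂_le fun ω _ => ?_
  rw [ratFunc_eval_div p q _ (hq ω), ← ofReal_norm, norm_div]
  exact ENNReal.ofReal_le_one.2 (div_le_one_of_le₀ (h ω) (norm_nonneg _))

/-- A stable platoon yields stable modes for every eigenvalue of its Laplacian that has an
eigenvector vanishing at the leader. -/
theorem PlatoonStable.mode_stable {R K : RatFunc ℝ} {n : ℕ} {ε : Fin (n + 1) → ℝ}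
    (h : PlatoonStable R K n ε) {x : ℝ} {v : Fin (n + 1) → ℝ} (hv : v ≠ 0) (hv0 : v 0 = 0)
    (hvx : (platoonLaplacian n ε).mulVec v = x • v) (z : ℂ)
    (hz : Polynomial.aeval z (R.denom * K.denom + Polynomial.C x * (R.num * K.num)) = 0) :
    z.re < 0 := by
  apply h
  refine map_platoonCharpoly_eq_zero (Polynomial.aeval z).toRingHom R K n ε
    (fun i => (v i.succ : ℂ)) (fun h' => hv ?_) fun i => ?_
  · ext i
    induction i using Fin.cases with
    | zero => exact hv0
    | succ i => simpa using congrFun h' i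
  · have hrow : ∑ j : Fin n, platoonLaplacian n ε i.succ j.succ * v j.succ = x * v i.succ := by
      have := congrFun hvx i.succ
      simpa [Matrix.mulVec, dotProduct, Fin.sum_univ_succ, hv0] using this
    have hrow' := congrArg (algebraMap ℝ ℂ) hrow
    simp only [map_sum, map_mul, Complex.coe_algebraMap] at hrow'
    simp only [map_add, map_mul, Polynomial.aeval_C, Complex.coe_algebraMap] at hz
    simp only [AlgHom.toRingHom_eq_coe, RingHom.coe_coe, map_mul, Polynomial.aeval_C,
      Complex.coe_algebraMap, hrow']
    linear_combination (v i.succ : ℂ) * hz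

theorem achievesPredecessorFollowing_of_le {R K : RatFunc ℝ} (hint : 1 ≤ numIntegrators (R * K))
    (hloop : hinfNorm (closedLoop (R * K)) ≤ 1) {x lam : ℝ} (hx0 : 0 < x) (hx1 : x ≤ 1)
    (hx : ∀ z : ℂ, Polynomial.aeval z (R.denom * K.denom + Polynomial.C x * (R.num * K.num)) = 0 →
      z.re < 0)
    (hlam0 : 0 < lam) (hlam : lam ≤ x) :
    AchievesPredecessorFollowing R (RatFunc.C lam * K) := by
  have hA : algebraMap ℝ[X] (RatFunc ℝ) (R.denom * K.denom) ≠ 0 :=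
    RatFunc.algebraMap_ne_zero (mul_ne_zero R.denom_ne_zero K.denom_ne_zero)
  have hloop' := closedLoop_C_mul R K 1
  rw [map_one, one_mul, map_one, one_mul] at hloop'
  have hq : R.denom * K.denom + R.num * K.num ≠ 0 := by
    intro h0
    apply (ne_zero_of_integrator hint).2
    rw [ratFunc_mul_eq_div R K, one_add_div hA, ← map_add, h0, map_zero, zero_div]
  have haxis1 := norm_aeval_le_of_hinfNorm_le_one _ _ hq (hloop' ▸ hloop)
  have haxis : ∀ t : ℝ, 0 ≤ t → t ≤ 1 → ∀ ω : ℝ,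
      ‖Polynomial.aeval ((ω : ℂ) * Complex.I) (Polynomial.C t * (R.num * K.num))‖ ≤
      ‖Polynomial.aeval ((ω : ℂ) * Complex.I)
        (R.denom * K.denom + Polynomial.C t * (R.num * K.num))‖ := by
    intro t ht0 ht1 ω
    have := haxis1 ω
    rw [map_add] at this
    rw [map_add, map_mul _ (Polynomial.C t), Polynomial.aeval_C]
    exact norm_le_norm_add_of_le _ _ 1 t ht0 one_pos ht1 (by simpa using this)
  have hstab : ∀ z : ℂ,
      Polynomial.aeval z (R.denom * K.denom + Polynomial.C lam * (R.num * K.num)) = 0 →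
      z.re < 0 := by
    intro z hz
    by_contra! hre
    have h1 := norm_aeval_le_of_axis_of_stable _ _ hx (haxis x hx0.le hx1) z hre
    rw [map_add, map_mul _ (Polynomial.C x), Polynomial.aeval_C] at h1
    have h2 := norm_le_norm_add_of_le _ _ x lam hlam0.le hx0 hlam h1
    rw [map_add, map_mul _ (Polynomial.C lam), Polynomial.aeval_C, Complex.coe_algebraMap] at hz
    -- At a zero of `A + λB` the bound leaves `λB = 0`; then `A` vanishes too, contradicting that `A
    -- + xB` is Hurwitz.
    rw [hz, norm_zero, norm_le_zero_iff, mul_eq_zero, Complex.ofReal_eq_zero] at h2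
    have hB := h2.resolve_left hlam0.ne'
    rw [hB, mul_zero, add_zero] at hz
    refine (hx z ?_).not_ge hre
    rw [map_add, map_mul _ (Polynomial.C x), hB, hz, mul_zero, add_zero]
  refine ⟨fun m z hz => ?_, le_antisymm ?_ ?_⟩
  · rw [platoonCharpoly_predecessor, denom_C_mul K hlam0.ne', num_C_mul K hlam0.ne',
      mul_left_comm R.num, map_pow] at hz
    exact hstab z (eq_zero_of_pow_eq_zero hz)
  · rw [closedLoop_C_mul]
    refine hinfNorm_div_le_one _ _ (fun ω h0 => ?_) (haxis lam hlam0.le (hlam.trans hx1))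
    simpa using hstab _ h0
  · rw [mul_left_comm]
    exact one_le_hinfNorm_closedLoop hint hlam0.ne'

theorem mainTheorem5 (R K : RatFunc ℝ) (n : ℕ) (hn : 1 ≤ n) (ε : Fin (n + 1) → ℝ)
    (hε : ∀ i, 0 ≤ ε i)
    (hint : 1 ≤ numIntegrators (R * K))
    (hstable : PlatoonStable R K n ε)
    (hstring : BidirectionallyStringStable R K n ε) :
    (∃ K' : RatFunc ℝ, AchievesPredecessorFollowing R K') ∧
    (∃ lam : ℝ, IsEigenvalueLowerBound n ε lam) ∧
    (∀ lam : ℝ, IsEigenvalueLowerBound n ε lam →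
      AchievesPredecessorFollowing R (RatFunc.C lam * K)) := by
  obtain ⟨m, rfl⟩ : ∃ m, n = m + 1 := ⟨n - 1, by omega⟩
  obtain ⟨x, hx0, hx1, v, hv, hv0, hvx⟩ := exists_eigenvector m ε hε
  obtain ⟨hM, hM1⟩ := ne_zero_of_integrator hint
  have hloop : hinfNorm (closedLoop (R * K)) ≤ 1 := by
    rw [← transferMatrix_ratio_last hstable hM hM1]
    exact (hstring 0 (Fin.last m)).1 (Fin.succ_pos _)
  have heig : Module.End.HasEigenvalue (Matrix.toLin' (platoonLaplacian (m + 1) ε)) x :=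
    Module.End.hasEigenvalue_of_hasEigenvector (x := v)
      ⟨Module.End.mem_eigenspace_iff.2 (by rw [Matrix.toLin'_apply, hvx]), hv⟩
  have hall : ∀ lam : ℝ, IsEigenvalueLowerBound (m + 1) ε lam →
      AchievesPredecessorFollowing R (RatFunc.C lam * K) := fun lam hlam =>
    achievesPredecessorFollowing_of_le hint hloop hx0 hx1 (hstable.mode_stable hv hv0 hvx)
      hlam.1 (hlam.2 x heig hx0.ne')
  obtain ⟨lam, hlam⟩ := exists_isEigenvalueLowerBound m ε hε
  exact ⟨⟨_, hall lam hlam⟩, ⟨lam, hlam⟩, hall⟩
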